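/- Let $A\in\mathbb{R}^{N\times N}$ be symmetric positive definite with smallest eigenvalue $\lambda_{\min}$, let $b,x_0\in\mathbb{R}^N$, let $x$ be the solution of $Ax=b$, and write $\|v\|_A=(v^TAv)^{1/2}$. Let $x_k,r_k,p_k$ be the vectors generated by the conjugate gradient method: $r_0=p_0=b-Ax_0$ and, for $k\ge 0$, $$\gamma_k=\frac{r_k^Tr_k}{p_k^TAp_k},\quad x_{k+1}=x_k+\gamma_kp_k,\quad r_{k+1}=r_k-\gamma_kAp_k,\quad \delta_{k+1}=\frac{r_{k+1}^Tr_{k+1}}{r_k^Tr_k},\quad p_{k+1}=r_{k+1}+\delta_{k+1}p_k .$$ Let $n$ be the grade of $r_0$ with respect to $A$, that is, the first index at which the dimension of the Krylov subspaces $\mathrm{span}\{r_0,Ar_0,\dots,A^{k-1}r_0\}$ attains its maximum. Let $0<\mu\le\lambda_{\min}$, put $\phi_k=\|r_k\|^2/\|p_k\|^2$, and define the Gauss–Radau coefficients by $$\gamma_0^{(\mu)}=\frac1\mu,\qquad \gamma_{k+1}^{(\mu)}=\frac{\gamma_k^{(\mu)}-\gamma_k}{\mu(\gamma_k^{(\mu)}-\gamma_k)+\delta_{k+1}},\qquad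 0\le k<n-1 .$$ 1. If $Ar_0\ne\mu r_0$, then for all $0\le k<n$ $$\|x-x_k\|_A^2<\frac{\|r_k\|^2}{\mu}\,\frac{\|r_k\|^2}{\|p_k\|^2},$$ while if $Ar_0=\mu r_0$, then equality holds for all $0\le k<n$ (that is, at most for $k=0$, since then $n\le 1$). 2. The bound $\frac{\|r_k\|^2}{\mu}\frac{\|r_k\|^2}{\|p_k\|^2}$ is strictly decreasing in $k$ for $0\le k<n$. 3. For all $0\le k<n$ one has $\mu\gamma_k^{(\mu)}\le\phi_k$, hence $\gamma_k^{(\mu)}\|r_k\|^2\le\frac{\|r_k\|^2}{\mu}\frac{\|r_k\|^2}{\|p_k\|^2}$, and the latter inequality is strict for $1\le k<n$. 4. For all integers $k\ge0$ and $d>0$ with $k+d<n$ $$\|x-x_k\|_A^2<\sum_{j=k}^{k+d-1}\gamma_j\|r_j\|^2+\frac{\|r_{k+d}\|^2}{\mu}\,\frac{\|r_{k+d}\|^2}{\|p_{k+d}\|^2}.$$ -/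

import Mathlib

noncomputable section

namespace CGBound

/-- Column vectors in `ℝ^N`, with the Euclidean inner product and norm. -/
abbrev Vec (N : ℕ) : Type := EuclideanSpace ℝ (Fin N)

/-- The matrix-vector product `A v`. -/
def mulV {N : ℕ} (A : Matrix (Fin N) (Fin N) ℝ) (v : Vec N) : Vec N :=
  Matrix.toEuclideanLin A v

/-- The Krylov subspace `span {v, A v, …, A^(k-1) v}`. -/
def krylov {N : ℕ} (A : Matrix (Fin N) (Fin N) ℝ) (v : Vec N) (k : ℕ) :
    Submodule ℝ (Vec N) :=
  Submodule.span ℝ ((fun j : ℕ => mulV (A ^ j) v) '' Set.Iio k)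

/-- The grade of `v` with respect to `A`: the first index at which the dimension of the
Krylov subspaces attains its maximum. -/
def grade {N : ℕ} (A : Matrix (Fin N) (Fin N) ℝ) (v : Vec N) : ℕ :=
  sInf {n : ℕ | ∀ k : ℕ,
    Module.finrank ℝ (krylov A v k) ≤ Module.finrank ℝ (krylov A v n)}

/-- The smallest eigenvalue of a real symmetric matrix (of positive order). -/
def lambdaMin {N : ℕ} (A : Matrix (Fin N) (Fin N) ℝ) : ℝ :=
  sInf (spectrum ℝ A)

/-- The `A`-norm `(vᵀ A v)^(1/2)`. -/
def aNorm {N : ℕ} (A : Matrix (Fin N) (Fin N) ℝ) (v : Vec N) : ℝ :=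
  Real.sqrt (inner ℝ v (mulV A v))

/-- The vectors carried by the conjugate gradient algorithm: the approximation `x`, the
residual `r` and the search direction `p`. -/
structure CGState (N : ℕ) where
  x : Vec N
  r : Vec N
  p : Vec N

/-- The coefficient `rᵀ r / pᵀ A p` of a state. -/
def stepLength {N : ℕ} (A : Matrix (Fin N) (Fin N) ℝ) (s : CGState N) : ℝ :=
  inner ℝ s.r s.r / inner ℝ s.p (mulV A s.p)

/-- One pass through the loop of the conjugate gradient algorithm. -/
def cgStep {N : ℕ} (A : Matrix (Fin N) (Fin N) ℝ) (s : CGState N) : CGState N :=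
  let g : ℝ := stepLength A s
  let r' : Vec N := s.r - g • mulV A s.p
  { x := s.x + g • s.p
    r := r'
    p := r' + (inner ℝ r' r' / inner ℝ s.r s.r : ℝ) • s.p }

/-- The conjugate gradient algorithm for `A x = b` started at `x₀`. -/
def cg {N : ℕ} (A : Matrix (Fin N) (Fin N) ℝ) (b x₀ : Vec N) : ℕ → CGState N
  | 0 => { x := x₀, r := b - mulV A x₀, p := b - mulV A x₀ }
  | k + 1 => cgStep A (cg A b x₀ k)

/-- The coefficient `γ_k = r_kᵀ r_k / p_kᵀ A p_k`. -/
def cgGamma {N : ℕ} (A : Matrix (Fin N) (Fin N) ℝ) (b x₀ : Vec N) (k : ℕ) : ℝ :=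
  stepLength A (cg A b x₀ k)

/-- The coefficient `δ_k = r_kᵀ r_k / r_{k-1}ᵀ r_{k-1}` for `k ≥ 1`, and `δ_0 = 0`. -/
def cgDelta {N : ℕ} (A : Matrix (Fin N) (Fin N) ℝ) (b x₀ : Vec N) : ℕ → ℝ
  | 0 => 0
  | k + 1 => inner ℝ (cg A b x₀ (k + 1)).r (cg A b x₀ (k + 1)).r /
      inner ℝ (cg A b x₀ k).r (cg A b x₀ k).r

/-- The Gauss–Radau coefficient `γ_k^{(μ)}`. -/
def radauGamma {N : ℕ} (A : Matrix (Fin N) (Fin N) ℝ) (b x₀ : Vec N) (μ : ℝ) : ℕ → ℝ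
  | 0 => 1 / μ
  | k + 1 =>
      (radauGamma A b x₀ μ k - cgGamma A b x₀ k) /
        (μ * (radauGamma A b x₀ μ k - cgGamma A b x₀ k) + cgDelta A b x₀ (k + 1))

/-- The ratio `φ_k = ‖r_k‖² / ‖p_k‖²`. -/
def cgPhi {N : ℕ} (A : Matrix (Fin N) (Fin N) ℝ) (b x₀ : Vec N) (k : ℕ) : ℝ :=
  ‖(cg A b x₀ k).r‖ ^ 2 / ‖(cg A b x₀ k).p‖ ^ 2

/-- The upper bound `(‖r_k‖² / μ) (‖r_k‖² / ‖p_k‖²)`. -/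
def newBound {N : ℕ} (A : Matrix (Fin N) (Fin N) ℝ) (b x₀ : Vec N) (μ : ℝ) (k : ℕ) : ℝ :=
  ‖(cg A b x₀ k).r‖ ^ 2 / μ * (‖(cg A b x₀ k).r‖ ^ 2 / ‖(cg A b x₀ k).p‖ ^ 2)

end CGBound

end

namespace CGBound
variable {N : ℕ} {A : Matrix (Fin N) (Fin N) ℝ} {b x₀ x : Vec N} {μ : ℝ}

/-! Write ε_k = x - x_k, so that r_k = A ε_k. The error bound rests on the identity (p_k, ε_k)‖r_k‖²
= ‖ε_k‖_A²‖p_k‖² (`inner_p_error`). Cauchy–Schwarz and μ‖ε_k‖² ≤ ‖ε_k‖_A² turn it into the bound,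
strictly unless A ε_k = μ ε_k. For k ≥ 1 that exception would force ‖p_k‖ = ‖r_k‖, against ‖p_k‖² =
‖r_k‖² + δ_k²‖p_{k-1}‖². Adding d steps of energy decrease gives the delayed bound.

Monotonicity and the Gauss–Radau comparison come from φ_{k+1} = φ_k / (φ_k + δ_{k+1}): the number
μγ_{k+1}^{(μ)} has the same form with φ_k replaced by μ(γ_k^{(μ)} - γ_k), and t ↦ t / (t + δ)
increases for t > 0. The positivity needed, γ_k < γ_k^{(μ)}, says that the pivots of the shifted
Lanczos matrix are positive (`radauGamma_pos_and_exists`). The grade enters only through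
`grade_le_of_r_eq_zero`: residuals below it are nonzero. -/

/-! ### The matrix-vector product and the Rayleigh bound -/

theorem mulV_add (u v : Vec N) : mulV A (u + v) = mulV A u + mulV A v := map_add _ _ _

theorem mulV_sub (u v : Vec N) : mulV A (u - v) = mulV A u - mulV A v := map_sub _ _ _

theorem mulV_smul (c : ℝ) (v : Vec N) : mulV A (c • v) = c • mulV A v := map_smul _ _ _

theorem inner_mulV_comm (hA : A.PosDef) (u v : Vec N) :
    inner ℝ (mulV A u) v = inner ℝ u (mulV A v) :=
  Matrix.isSymmetric_toEuclideanLin_iff.2 hA.1 u v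

theorem inner_mulV_pos (hA : A.PosDef) {v : Vec N} (hv : v ≠ 0) :
    0 < (inner ℝ v (mulV A v) : ℝ) := by
  have h := hA.dotProduct_mulVec_pos (x := v.ofLp) (by simpa using hv)
  simpa [mulV, EuclideanSpace.inner_eq_star_dotProduct, dotProduct_comm] using h

theorem inner_mulV_nonneg (hA : A.PosDef) (v : Vec N) :
    0 ≤ (inner ℝ v (mulV A v) : ℝ) := by
  rcases eq_or_ne v 0 with rfl | hv
  · simp
  · exact (inner_mulV_pos hA hv).le

theorem posSemidef_sub_smul_one (hA : A.PosDef) (hμ : μ ≤ lambdaMin A) :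
    (A - μ • (1 : Matrix (Fin N) (Fin N) ℝ)).PosSemidef := by
  rw [Matrix.posSemidef_iff_isHermitian_and_spectrum_nonneg]
  refine ⟨hA.1.sub ((Matrix.isHermitian_one).smul (star_trivial μ)), fun c hc => ?_⟩
  rw [← Algebra.algebraMap_eq_smul_one, ← spectrum.sub_singleton_eq] at hc
  obtain ⟨a, ha, m, rfl, rfl⟩ := Set.mem_sub.1 hc
  have hbdd : BddBelow (spectrum ℝ A) :=
    ⟨0, fun c hc => (Matrix.posSemidef_iff_isHermitian_and_spectrum_nonneg.1 hA.posSemidef).2 hc⟩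
  exact sub_nonneg.2 (hμ.trans (csInf_le hbdd ha))

theorem dotProduct_sub_smul_one_mulVec (A : Matrix (Fin N) (Fin N) ℝ) (μ : ℝ) (v : Vec N) :
    star v.ofLp ⬝ᵥ (A - μ • (1 : Matrix (Fin N) (Fin N) ℝ)).mulVec v.ofLp =
      inner ℝ v (mulV A v) - μ * ‖v‖ ^ 2 := by
  have h : v.ofLp ⬝ᵥ v.ofLp = ‖v‖ ^ 2 := by
    rw [← real_inner_self_eq_norm_sq, EuclideanSpace.inner_eq_star_dotProduct, star_trivial]
  simp [mulV, EuclideanSpace.inner_eq_star_dotProduct, dotProduct_comm, Matrix.sub_mulVec,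
    Matrix.smul_mulVec, dotProduct_sub, h]

theorem mul_norm_sq_le (hA : A.PosDef) (hμ : μ ≤ lambdaMin A) (v : Vec N) :
    μ * ‖v‖ ^ 2 ≤ inner ℝ v (mulV A v) := by
  have h := (posSemidef_sub_smul_one hA hμ).dotProduct_mulVec_nonneg v.ofLp
  rw [dotProduct_sub_smul_one_mulVec] at h
  linarith

theorem mulV_eq_smul_of_inner_eq (hA : A.PosDef) (hμ : μ ≤ lambdaMin A) {v : Vec N}
    (hv : inner ℝ v (mulV A v) = μ * ‖v‖ ^ 2) : mulV A v = μ • v := by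
  have h := (posSemidef_sub_smul_one hA hμ).dotProduct_mulVec_zero_iff v.ofLp
  rw [dotProduct_sub_smul_one_mulVec, hv, sub_self, eq_self, true_iff, Matrix.sub_mulVec,
    Matrix.smul_mulVec, Matrix.one_mulVec, sub_eq_zero] at h
  ext i
  simpa [mulV] using congrFun h i

/-! ### Recurrences, local orthogonality and the error identity -/

theorem cg_x_succ (k : ℕ) :
    (cg A b x₀ (k + 1)).x = (cg A b x₀ k).x + cgGamma A b x₀ k • (cg A b x₀ k).p := rfl

theorem cg_r_succ (k : ℕ) :
    (cg A b x₀ (k + 1)).r = (cg A b x₀ k).r - cgGamma A b x₀ k • mulV A (cg A b x₀ k).p := rfl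

theorem cg_p_succ (k : ℕ) :
    (cg A b x₀ (k + 1)).p =
      (cg A b x₀ (k + 1)).r + cgDelta A b x₀ (k + 1) • (cg A b x₀ k).p := rfl

theorem cg_r_eq (hx : mulV A x = b) (k : ℕ) :
    (cg A b x₀ k).r = mulV A (x - (cg A b x₀ k).x) := by
  induction k with
  | zero => simp [cg, mulV_sub, hx]
  | succ k ih => rw [cg_r_succ, ih, cg_x_succ, ← sub_sub, mulV_sub _ (_ • _), mulV_smul]

/-- Stated with `h` as a hypothesis because the induction proving `h` for every k uses it. -/
theorem cgGamma_mul_of_inner (hA : A.PosDef) {k : ℕ}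
    (h : inner ℝ (cg A b x₀ k).p (cg A b x₀ k).r = ‖(cg A b x₀ k).r‖ ^ 2) :
    cgGamma A b x₀ k * inner ℝ (cg A b x₀ k).p (mulV A (cg A b x₀ k).p) =
      ‖(cg A b x₀ k).r‖ ^ 2 := by
  rw [cgGamma, stepLength, real_inner_self_eq_norm_sq]
  by_cases hp : (cg A b x₀ k).p = 0
  -- If p_k = 0, then `h` makes r_k vanish too, so the identity survives division by zero.
  · rw [← h]; simp [hp]
  · rw [div_mul_cancel₀ _ (inner_mulV_pos hA hp).ne']

theorem inner_r_succ_p_of_inner (hA : A.PosDef) {k : ℕ}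
    (h : inner ℝ (cg A b x₀ k).p (cg A b x₀ k).r = ‖(cg A b x₀ k).r‖ ^ 2) :
    inner ℝ (cg A b x₀ k).p (cg A b x₀ (k + 1)).r = (0 : ℝ) := by
  rw [cg_r_succ, inner_sub_right, inner_smul_right, cgGamma_mul_of_inner hA h, h, sub_self]

theorem inner_p_r (hA : A.PosDef) (k : ℕ) :
    inner ℝ (cg A b x₀ k).p (cg A b x₀ k).r = ‖(cg A b x₀ k).r‖ ^ 2 := by
  induction k with
  | zero => exact real_inner_self_eq_norm_sq _
  | succ k ih =>
    rw [cg_p_succ, inner_add_left, inner_smul_left, inner_r_succ_p_of_inner hA ih,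
      real_inner_self_eq_norm_sq, mul_zero, add_zero]

theorem cgGamma_mul (hA : A.PosDef) (k : ℕ) :
    cgGamma A b x₀ k * inner ℝ (cg A b x₀ k).p (mulV A (cg A b x₀ k).p) =
      ‖(cg A b x₀ k).r‖ ^ 2 :=
  cgGamma_mul_of_inner hA (inner_p_r hA k)

theorem inner_p_r_succ (hA : A.PosDef) (k : ℕ) :
    inner ℝ (cg A b x₀ k).p (cg A b x₀ (k + 1)).r = (0 : ℝ) :=
  inner_r_succ_p_of_inner hA (inner_p_r hA k)

theorem cgDelta_mul (k : ℕ) :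
    cgDelta A b x₀ (k + 1) * ‖(cg A b x₀ k).r‖ ^ 2 = ‖(cg A b x₀ (k + 1)).r‖ ^ 2 := by
  rw [cgDelta, real_inner_self_eq_norm_sq, real_inner_self_eq_norm_sq]
  by_cases hr : (cg A b x₀ k).r = 0
  · simp [hr, cg_r_succ, cgGamma, stepLength]
  · rw [div_mul_cancel₀ _ (by simpa using hr)]

theorem norm_p_succ (hA : A.PosDef) (k : ℕ) :
    ‖(cg A b x₀ (k + 1)).p‖ ^ 2 =
      ‖(cg A b x₀ (k + 1)).r‖ ^ 2 + cgDelta A b x₀ (k + 1) ^ 2 * ‖(cg A b x₀ k).p‖ ^ 2 := by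
  rw [cg_p_succ, norm_add_sq_real, inner_smul_right, real_inner_comm, inner_p_r_succ hA,
    norm_smul, mul_pow, Real.norm_eq_abs, sq_abs]
  ring

theorem error_succ (k : ℕ) :
    x - (cg A b x₀ (k + 1)).x =
      (x - (cg A b x₀ k).x) - cgGamma A b x₀ k • (cg A b x₀ k).p := by
  rw [cg_x_succ, sub_sub]

theorem aNorm_sq (hA : A.PosDef) (v : Vec N) : aNorm A v ^ 2 = inner ℝ v (mulV A v) :=
  Real.sq_sqrt (inner_mulV_nonneg hA v)

theorem energy_succ (hA : A.PosDef) (hx : mulV A x = b) (k : ℕ) :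
    aNorm A (x - (cg A b x₀ (k + 1)).x) ^ 2 =
      aNorm A (x - (cg A b x₀ k).x) ^ 2 - cgGamma A b x₀ k * ‖(cg A b x₀ k).r‖ ^ 2 := by
  have h2 := inner_p_r (b := b) (x₀ := x₀) hA k
  have h3 := cgGamma_mul (b := b) (x₀ := x₀) hA k
  have h4 := cg_r_eq (x₀ := x₀) hx k
  rw [aNorm_sq hA, aNorm_sq hA, error_succ]
  generalize x - (cg A b x₀ k).x = ε at h4 ⊢
  have h1 := inner_mulV_comm hA ε (cg A b x₀ k).p
  rw [← h4, real_inner_comm, h2] at h1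
  rw [mulV_sub, mulV_smul, ← h4, inner_sub_right, inner_sub_left, inner_sub_left,
    inner_smul_left, inner_smul_right, inner_smul_right, inner_smul_left, ← h1, h2]
  simp only [conj_trivial]
  linear_combination cgGamma A b x₀ k * h3

/-- In the induction, (p_{k+1}, ε_{k+1}) = ‖ε_{k+1}‖_A² + δ((p_k, ε_k) - γ_k‖p_k‖²). The energy
decrease turns the bracket into ‖ε_{k+1}‖_A²‖p_k‖²/‖r_k‖², and `norm_p_succ` collects the terms. -/
theorem inner_p_error (hA : A.PosDef) (hx : mulV A x = b) (k : ℕ) :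
    inner ℝ (cg A b x₀ k).p (x - (cg A b x₀ k).x) * ‖(cg A b x₀ k).r‖ ^ 2 =
      aNorm A (x - (cg A b x₀ k).x) ^ 2 * ‖(cg A b x₀ k).p‖ ^ 2 := by
  induction k with
  | zero =>
    rw [aNorm_sq hA, ← cg_r_eq hx, real_inner_comm]
    rfl
  | succ k ih =>
    have h1 : inner ℝ (cg A b x₀ (k + 1)).r (x - (cg A b x₀ (k + 1)).x) =
        aNorm A (x - (cg A b x₀ (k + 1)).x) ^ 2 := by
      rw [aNorm_sq hA, cg_r_eq hx, real_inner_comm]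
    have h2 : inner ℝ (cg A b x₀ k).p (x - (cg A b x₀ (k + 1)).x) =
        inner ℝ (cg A b x₀ k).p (x - (cg A b x₀ k).x) -
          cgGamma A b x₀ k * ‖(cg A b x₀ k).p‖ ^ 2 := by
      rw [error_succ, inner_sub_right, inner_smul_right, real_inner_self_eq_norm_sq]
    have h3 := energy_succ (x₀ := x₀) hA hx k
    have h4 := cgDelta_mul (A := A) (b := b) (x₀ := x₀) k
    rw [norm_p_succ hA, cg_p_succ, inner_add_left, inner_smul_left, h1, h2, ← h4]
    simp only [conj_trivial]
    linear_combination cgDelta A b x₀ (k + 1) ^ 2 * ih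
      - cgDelta A b x₀ (k + 1) ^ 2 * ‖(cg A b x₀ k).p‖ ^ 2 * h3

/-! ### Positivity and monotonicity of the bound -/

theorem p_ne_zero (hA : A.PosDef) {k : ℕ} (hr : (cg A b x₀ k).r ≠ 0) : (cg A b x₀ k).p ≠ 0 := by
  intro hp
  have h := inner_p_r (b := b) (x₀ := x₀) hA k
  rw [hp, inner_zero_left, eq_comm, sq_eq_zero_iff, norm_eq_zero] at h
  exact hr h

theorem cgGamma_pos (hA : A.PosDef) {k : ℕ} (hr : (cg A b x₀ k).r ≠ 0) :
    0 < cgGamma A b x₀ k :=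
  div_pos (real_inner_self_pos.2 hr) (inner_mulV_pos hA (p_ne_zero hA hr))

theorem cgDelta_pos {k : ℕ} (hr : (cg A b x₀ k).r ≠ 0) (hr' : (cg A b x₀ (k + 1)).r ≠ 0) :
    0 < cgDelta A b x₀ (k + 1) :=
  div_pos (real_inner_self_pos.2 hr') (real_inner_self_pos.2 hr)

theorem cgPhi_pos (hA : A.PosDef) {k : ℕ} (hr : (cg A b x₀ k).r ≠ 0) : 0 < cgPhi A b x₀ k := by
  have := norm_pos_iff.2 hr
  have := norm_pos_iff.2 (p_ne_zero hA hr)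
  unfold cgPhi
  positivity

theorem cgPhi_succ (hA : A.PosDef) {k : ℕ} (hr : (cg A b x₀ k).r ≠ 0)
    (hr' : (cg A b x₀ (k + 1)).r ≠ 0) :
    cgPhi A b x₀ (k + 1) = cgPhi A b x₀ k / (cgPhi A b x₀ k + cgDelta A b x₀ (k + 1)) := by
  have h1 := norm_pos_iff.2 hr
  have h2 := norm_pos_iff.2 (p_ne_zero hA hr)
  have h3 := cgDelta_pos hr hr'
  unfold cgPhi
  rw [norm_p_succ hA, ← cgDelta_mul]
  field_simp

theorem newBound_eq (k : ℕ) :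
    newBound A b x₀ μ k = ‖(cg A b x₀ k).r‖ ^ 2 / μ * cgPhi A b x₀ k := rfl

/-- One step multiplies the bound by δ_{k+1} / (φ_k + δ_{k+1}) < 1. -/
theorem newBound_succ_lt (hA : A.PosDef) (hμ : 0 < μ) {k : ℕ} (hr : (cg A b x₀ k).r ≠ 0)
    (hr' : (cg A b x₀ (k + 1)).r ≠ 0) :
    newBound A b x₀ μ (k + 1) < newBound A b x₀ μ k := by
  have h1 := norm_pos_iff.2 hr
  have h2 := cgPhi_pos hA hr
  have h3 := cgDelta_pos hr hr'
  rw [newBound_eq, newBound_eq, cgPhi_succ hA hr hr', ← cgDelta_mul, div_mul_div_comm,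
    div_mul_eq_mul_div, div_lt_div_iff₀ (by positivity) hμ]
  have : 0 < ‖(cg A b x₀ k).r‖ ^ 2 * cgPhi A b x₀ k * μ * cgPhi A b x₀ k := by positivity
  linarith

/-! ### The error bound and its equality case -/

theorem energy_lt_newBound (hA : A.PosDef) (hx : mulV A x = b) (hμ0 : 0 < μ)
    (hμ : μ ≤ lambdaMin A) {k : ℕ} (hr : (cg A b x₀ k).r ≠ 0)
    (h : mulV A (x - (cg A b x₀ k).x) ≠ μ • (x - (cg A b x₀ k).x)) :
    aNorm A (x - (cg A b x₀ k).x) ^ 2 < newBound A b x₀ μ k := by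
  have hp := norm_pos_iff.2 (p_ne_zero hA hr)
  have hr0 := norm_pos_iff.2 hr
  have hkey := inner_p_error (x₀ := x₀) hA hx k
  have hle : μ * ‖x - (cg A b x₀ k).x‖ ^ 2 < aNorm A (x - (cg A b x₀ k).x) ^ 2 := by
    rw [aNorm_sq hA]
    exact lt_of_le_of_ne (mul_norm_sq_le hA hμ _)
      fun he => h (mulV_eq_smul_of_inner_eq hA hμ he.symm)
  have hcs := real_inner_mul_inner_self_le (cg A b x₀ k).p (x - (cg A b x₀ k).x)
  rw [real_inner_self_eq_norm_sq, real_inner_self_eq_norm_sq] at hcs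
  unfold newBound
  set e := aNorm A (x - (cg A b x₀ k).x) ^ 2
  set R := ‖(cg A b x₀ k).r‖ ^ 2 with hR
  set P := ‖(cg A b x₀ k).p‖ ^ 2 with hP
  set E := ‖x - (cg A b x₀ k).x‖ ^ 2
  set t : ℝ := inner ℝ (cg A b x₀ k).p (x - (cg A b x₀ k).x)
  have hRp : 0 < R := by positivity
  have hPp : 0 < P := by positivity
  have hE : 0 ≤ E := by positivity
  have he : 0 < e := lt_of_le_of_lt (by positivity) hle
  -- Cauchy–Schwarz for p_k and ε_k, with the inner product eliminated by the identity `hkey`.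
  have h1 : e ^ 2 * P ≤ E * R ^ 2 := by
    have h2 : (e * P) ^ 2 ≤ P * (E * R ^ 2) := by
      rw [← hkey]
      calc (t * R) ^ 2 = t * t * R ^ 2 := by ring
        _ ≤ P * E * R ^ 2 := by gcongr
        _ = P * (E * R ^ 2) := by ring
    refine le_of_mul_le_mul_left ?_ hPp
    linarith
  rw [div_mul_div_comm, lt_div_iff₀ (by positivity)]
  refine lt_of_mul_lt_mul_left ?_ he.le
  calc e * (e * (μ * P)) = μ * (e ^ 2 * P) := by ring
    _ ≤ μ * (E * R ^ 2) := by gcongr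
    _ = (μ * E) * R ^ 2 := by ring
    _ < e * R ^ 2 := by gcongr
    _ = e * (R * R) := by ring
theorem r_ne_zero_of_succ {k : ℕ} (hr : (cg A b x₀ (k + 1)).r ≠ 0) : (cg A b x₀ k).r ≠ 0 := by
  intro h
  have := cgDelta_mul (A := A) (b := b) (x₀ := x₀) k
  rw [h, norm_zero, zero_pow two_ne_zero, mul_zero, eq_comm, sq_eq_zero_iff, norm_eq_zero] at this
  exact hr this

theorem r_ne_zero_of_le {j k : ℕ} (hjk : j ≤ k) (hr : (cg A b x₀ k).r ≠ 0) :
    (cg A b x₀ j).r ≠ 0 := by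
  induction k, hjk using Nat.le_induction with
  | base => exact hr
  | succ k _ ih => exact ih (r_ne_zero_of_succ hr)

/-- Otherwise ε = μ⁻¹ r, and `inner_p_error` would give ‖p‖ = ‖r‖, whereas p has the extra
orthogonal component δ p_k ≠ 0. -/
theorem error_ne_eigenvector_succ (hA : A.PosDef) (hx : mulV A x = b) (hμ : 0 < μ) {k : ℕ}
    (hr : (cg A b x₀ (k + 1)).r ≠ 0) :
    mulV A (x - (cg A b x₀ (k + 1)).x) ≠ μ • (x - (cg A b x₀ (k + 1)).x) := by
  intro h
  have hkey := inner_p_error (x₀ := x₀) hA hx (k + 1)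
  have hε : x - (cg A b x₀ (k + 1)).x = μ⁻¹ • (cg A b x₀ (k + 1)).r := by
    rw [cg_r_eq hx, h, smul_smul, inv_mul_cancel₀ hμ.ne', one_smul]
  rw [aNorm_sq hA, ← cg_r_eq hx, hε, inner_smul_left, inner_smul_right, inner_p_r hA,
    norm_p_succ hA, real_inner_self_eq_norm_sq, conj_trivial] at hkey
  have h1 := norm_pos_iff.2 hr
  have h2 := norm_pos_iff.2 (p_ne_zero hA (r_ne_zero_of_succ hr))
  have h3 := cgDelta_pos (r_ne_zero_of_succ hr) hr
  have : 0 < μ⁻¹ * ‖(cg A b x₀ (k + 1)).r‖ ^ 2 *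
      (cgDelta A b x₀ (k + 1) ^ 2 * ‖(cg A b x₀ k).p‖ ^ 2) := by positivity
  linarith

theorem energy_succ_lt_newBound (hA : A.PosDef) (hx : mulV A x = b) (hμ0 : 0 < μ)
    (hμ : μ ≤ lambdaMin A) {k : ℕ} (hr : (cg A b x₀ (k + 1)).r ≠ 0) :
    aNorm A (x - (cg A b x₀ (k + 1)).x) ^ 2 < newBound A b x₀ μ (k + 1) :=
  energy_lt_newBound hA hx hμ0 hμ hr (error_ne_eigenvector_succ hA hx hμ0 hr)

theorem energy_zero_lt_newBound (hA : A.PosDef) (hx : mulV A x = b) (hμ0 : 0 < μ)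
    (hμ : μ ≤ lambdaMin A) (hr : b - mulV A x₀ ≠ 0)
    (h : mulV A (b - mulV A x₀) ≠ μ • (b - mulV A x₀)) :
    aNorm A (x - (cg A b x₀ 0).x) ^ 2 < newBound A b x₀ μ 0 := by
  refine energy_lt_newBound hA hx hμ0 hμ hr fun he => h ?_
  rw [← cg_r_eq (x₀ := x₀) hx 0] at he
  change b - mulV A x₀ = _ at he
  nth_rw 1 [he, mulV_smul]
  rw [← cg_r_eq hx]
  rfl

/-- For a nonzero eigenvector r_0 the first step length is exactly 1/μ, so one step solves the
system. -/
theorem r_one_eq_zero (hμ : 0 < μ) (h : mulV A (b - mulV A x₀) = μ • (b - mulV A x₀)) :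
    (cg A b x₀ 1).r = 0 := by
  change (b - mulV A x₀) - (inner ℝ (b - mulV A x₀) (b - mulV A x₀) /
    inner ℝ (b - mulV A x₀) (mulV A (b - mulV A x₀)) : ℝ) • mulV A (b - mulV A x₀) = 0
  rw [h]
  by_cases hr : b - mulV A x₀ = 0
  · simp [hr]
  · rw [inner_smul_right, smul_smul, div_mul_eq_mul_div, mul_comm μ,
      div_self (mul_pos (real_inner_self_pos.2 hr) hμ).ne', one_smul, sub_self]

theorem energy_zero_eq_newBound (hA : A.PosDef) (hx : mulV A x = b) (hμ : 0 < μ)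
    (h : mulV A (b - mulV A x₀) = μ • (b - mulV A x₀)) :
    aNorm A (x - (cg A b x₀ 0).x) ^ 2 = newBound A b x₀ μ 0 := by
  have h1 : aNorm A (x - (cg A b x₀ 1).x) ^ 2 = 0 := by
    rw [aNorm_sq hA, ← cg_r_eq hx, r_one_eq_zero hμ h, inner_zero_right]
  rw [energy_succ hA hx 0, sub_eq_zero] at h1
  rw [h1]
  change (inner ℝ (b - mulV A x₀) (b - mulV A x₀) /
    inner ℝ (b - mulV A x₀) (mulV A (b - mulV A x₀)) : ℝ) * ‖b - mulV A x₀‖ ^ 2 =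
    ‖b - mulV A x₀‖ ^ 2 / μ * (‖b - mulV A x₀‖ ^ 2 / ‖b - mulV A x₀‖ ^ 2)
  rw [h, inner_smul_right, real_inner_self_eq_norm_sq]
  by_cases hr : b - mulV A x₀ = 0
  · simp [hr]
  · have := norm_ne_zero_iff.2 hr
    field_simp

theorem energy_eq_sum (hA : A.PosDef) (hx : mulV A x = b) (k d : ℕ) :
    aNorm A (x - (cg A b x₀ k).x) ^ 2 =
      ∑ j ∈ Finset.Ico k (k + d), cgGamma A b x₀ j * ‖(cg A b x₀ j).r‖ ^ 2 +
        aNorm A (x - (cg A b x₀ (k + d)).x) ^ 2 := by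
  induction d with
  | zero => simp
  | succ d ih =>
    rw [← add_assoc, Finset.sum_Ico_succ_top (by omega), energy_succ hA hx, ih]
    ring


/-! ### Global orthogonality and conjugacy -/

theorem mulV_p_eq (hA : A.PosDef) {k : ℕ} (hr : (cg A b x₀ k).r ≠ 0) :
    mulV A (cg A b x₀ k).p =
      (cgGamma A b x₀ k)⁻¹ • ((cg A b x₀ k).r - (cg A b x₀ (k + 1)).r) := by
  rw [cg_r_succ, sub_sub_cancel, smul_smul, inv_mul_cancel₀ (cgGamma_pos hA hr).ne', one_smul]

theorem inner_r_eq_zero_of_inner_p {m : ℕ} {v : Vec N}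
    (h : ∀ j < m, inner ℝ (cg A b x₀ j).p v = (0 : ℝ)) :
    ∀ j < m, inner ℝ (cg A b x₀ j).r v = (0 : ℝ) := by
  intro j hj
  cases j with
  | zero => exact h 0 hj
  | succ j =>
    have h1 := h (j + 1) hj
    rwa [cg_p_succ, inner_add_left, inner_smul_left, h j (by omega), mul_zero, add_zero] at h1

theorem inner_p_mulV_p_and_inner_p_r (hA : A.PosDef) (m : ℕ) (hr : (cg A b x₀ m).r ≠ 0) :
    ∀ j < m, inner ℝ (cg A b x₀ j).p (mulV A (cg A b x₀ m).p) = (0 : ℝ) ∧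
      inner ℝ (cg A b x₀ j).p (cg A b x₀ m).r = (0 : ℝ) := by
  induction m with
  | zero => intro j hj; omega
  | succ m ih =>
    have hrm := r_ne_zero_of_succ hr
    specialize ih hrm
    have hpr : ∀ j < m + 1, inner ℝ (cg A b x₀ j).p (cg A b x₀ (m + 1)).r = (0 : ℝ) := by
      intro j hj
      rcases Nat.lt_succ_iff_lt_or_eq.1 hj with hj | rfl
      · rw [cg_r_succ, inner_sub_right, inner_smul_right, (ih j hj).1, (ih j hj).2]
        simp
      · exact inner_p_r_succ hA j
    have hrr := inner_r_eq_zero_of_inner_p hpr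
    refine fun j hj => ⟨?_, hpr j hj⟩
    -- Moving A onto p_j leaves (r_j - r_{j+1})/γ_j against r_{m+1}; it is nonzero only for j = m,
    -- where δ_{m+1} cancels it.
    rw [cg_p_succ m, mulV_add, mulV_smul, inner_add_right, inner_smul_right,
      ← inner_mulV_comm hA, mulV_p_eq hA (r_ne_zero_of_le (by omega) hr), inner_smul_left,
      inner_sub_left, hrr j hj]
    rcases Nat.lt_succ_iff_lt_or_eq.1 hj with hj | rfl
    · rw [hrr (j + 1) (by omega), (ih j hj).1]
      simp
    · have h1 := cgGamma_mul (b := b) (x₀ := x₀) hA j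
      have h2 := cgDelta_mul (A := A) (b := b) (x₀ := x₀) j
      have h3 := (cgGamma_pos hA hrm).ne'
      rw [real_inner_self_eq_norm_sq, ← h2, ← h1, conj_trivial]
      field_simp
      ring

theorem inner_r_r_eq_zero (hA : A.PosDef) {j m : ℕ} (hjm : j < m) (hr : (cg A b x₀ m).r ≠ 0) :
    inner ℝ (cg A b x₀ j).r (cg A b x₀ m).r = (0 : ℝ) :=
  inner_r_eq_zero_of_inner_p (fun j hj => (inner_p_mulV_p_and_inner_p_r hA m hr j hj).2) j hjm

/-! ### The Lanczos relation and the Gauss–Radau coefficients -/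

theorem mulV_r_succ (hA : A.PosDef) {k : ℕ} (hr : (cg A b x₀ (k + 1)).r ≠ 0) :
    mulV A (cg A b x₀ (k + 1)).r =
      (cgGamma A b x₀ (k + 1))⁻¹ • ((cg A b x₀ (k + 1)).r - (cg A b x₀ (k + 2)).r) -
        (cgDelta A b x₀ (k + 1) * (cgGamma A b x₀ k)⁻¹) •
          ((cg A b x₀ k).r - (cg A b x₀ (k + 1)).r) := by
  rw [mul_smul, ← mulV_p_eq hA hr, ← mulV_p_eq hA (r_ne_zero_of_succ hr), ← mulV_smul,
    ← mulV_sub, cg_p_succ, add_sub_cancel_right]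

/-- The vectors produced by eliminating the shifted Lanczos matrix `T - μ I` satisfy a
two-term residual relation; the coefficient of `r_k` is the pivot `1 / γ_k - 1 / γ_k^{(μ)}`. -/
theorem cgGamma_lt_radauGamma_of_exists (hA : A.PosDef) (hμ : μ ≤ lambdaMin A) {k : ℕ}
    (hr : (cg A b x₀ (k + 1)).r ≠ 0) (hpos : 0 < radauGamma A b x₀ μ k)
    (h : ∃ q : Vec N, mulV A q - μ • q =
        ((cgGamma A b x₀ k)⁻¹ - (radauGamma A b x₀ μ k)⁻¹) • (cg A b x₀ k).r -
          (cgGamma A b x₀ k)⁻¹ • (cg A b x₀ (k + 1)).r ∧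
      inner ℝ q (cg A b x₀ k).r = ‖(cg A b x₀ k).r‖ ^ 2 ∧
      inner ℝ q (cg A b x₀ (k + 1)).r = (0 : ℝ)) :
    cgGamma A b x₀ k < radauGamma A b x₀ μ k := by
  obtain ⟨q, hq, hqr, hqr'⟩ := h
  have hrk := r_ne_zero_of_succ hr
  have hγ := cgGamma_pos hA hrk
  have hform : inner ℝ q (mulV A q) - μ * ‖q‖ ^ 2 =
      ((cgGamma A b x₀ k)⁻¹ - (radauGamma A b x₀ μ k)⁻¹) * ‖(cg A b x₀ k).r‖ ^ 2 := by
    rw [← real_inner_self_eq_norm_sq q, ← inner_smul_right, ← inner_sub_right, hq,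
      inner_sub_right, inner_smul_right, inner_smul_right, hqr, hqr', mul_zero, sub_zero]
  have hlt : 0 < inner ℝ q (mulV A q) - μ * ‖q‖ ^ 2 := by
    -- Equality would give A q = μ q; pairing `hq` with r_{k+1} then contradicts r_{k+1} ≠ 0.
    refine lt_of_le_of_ne (sub_nonneg.2 (mul_norm_sq_le hA hμ q)) fun h0 => ?_
    have h1 := mulV_eq_smul_of_inner_eq hA hμ (sub_eq_zero.1 h0.symm)
    have h2 := congrArg (fun v => (inner ℝ v (cg A b x₀ (k + 1)).r : ℝ)) hq
    simp only [h1, sub_self, inner_zero_left, inner_sub_left, inner_smul_left,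
      inner_r_r_eq_zero hA k.lt_succ_self hr, real_inner_self_eq_norm_sq, conj_trivial] at h2
    have := norm_pos_iff.2 hr
    have : 0 < (cgGamma A b x₀ k)⁻¹ * ‖(cg A b x₀ (k + 1)).r‖ ^ 2 := by positivity
    linarith
  rw [hform] at hlt
  have h1 := pos_of_mul_pos_left hlt (by positivity)
  exact (inv_lt_inv₀ hpos hγ).1 (sub_pos.1 h1)

/-- Forward elimination on T - μI. Orthogonality of q to all later nonzero residuals is what carries
the induction on. -/
theorem radauGamma_pos_and_exists (hA : A.PosDef) (hμ0 : 0 < μ) (hμ : μ ≤ lambdaMin A) (k : ℕ)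
    (hr : (cg A b x₀ k).r ≠ 0) :
    0 < radauGamma A b x₀ μ k ∧ ∃ q : Vec N, mulV A q - μ • q =
        ((cgGamma A b x₀ k)⁻¹ - (radauGamma A b x₀ μ k)⁻¹) • (cg A b x₀ k).r -
          (cgGamma A b x₀ k)⁻¹ • (cg A b x₀ (k + 1)).r ∧
      inner ℝ q (cg A b x₀ k).r = ‖(cg A b x₀ k).r‖ ^ 2 ∧
      ∀ m, k < m → (cg A b x₀ m).r ≠ 0 → inner ℝ q (cg A b x₀ m).r = (0 : ℝ) := by
  induction k with
  | zero =>
    refine ⟨one_div_pos.2 hμ0, (cg A b x₀ 0).r, ?_, real_inner_self_eq_norm_sq _,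
      fun m hm hr => inner_r_r_eq_zero hA hm hr⟩
    have h : mulV A (cg A b x₀ 0).r = _ := mulV_p_eq hA hr
    rw [h, radauGamma, one_div, inv_inv]
    module
  | succ k ih =>
    have hrk := r_ne_zero_of_succ hr
    obtain ⟨hg, q, hq, hqr, hqm⟩ := ih hrk
    have hlt := cgGamma_lt_radauGamma_of_exists hA hμ hr hg
      ⟨q, hq, hqr, hqm _ k.lt_succ_self hr⟩
    have hγ := cgGamma_pos hA hrk
    have hδ := cgDelta_pos hrk hr
    have hsub := sub_pos.2 hlt
    have hden : 0 < μ * (radauGamma A b x₀ μ k - cgGamma A b x₀ k) + cgDelta A b x₀ (k + 1) := by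
      positivity
    have hinv : (radauGamma A b x₀ μ (k + 1))⁻¹ =
        μ + cgDelta A b x₀ (k + 1) / (radauGamma A b x₀ μ k - cgGamma A b x₀ k) := by
      rw [radauGamma, inv_div, add_div, mul_div_cancel_right₀ _ hsub.ne']
    -- The multiplier of q is the one that cancels r_k in (A - μ)q'.
    refine ⟨div_pos hsub hden, (cg A b x₀ (k + 1)).r +
      (cgDelta A b x₀ (k + 1) * radauGamma A b x₀ μ k /
        (radauGamma A b x₀ μ k - cgGamma A b x₀ k)) • q, ?_, ?_, ?_⟩
    · rw [mulV_add, mulV_smul, smul_add, smul_comm μ, add_sub_add_comm, ← smul_sub, hq,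
        mulV_r_succ hA hr, hinv]
      match_scalars <;> field_simp <;> ring
    · rw [inner_add_left, inner_smul_left, hqm _ k.lt_succ_self hr, mul_zero, add_zero,
        real_inner_self_eq_norm_sq]
    · intro m hm hrm
      rw [inner_add_left, inner_smul_left, hqm m (by omega) hrm, mul_zero, add_zero,
        inner_r_r_eq_zero hA hm hrm]

theorem cgGamma_lt_radauGamma (hA : A.PosDef) (hμ0 : 0 < μ) (hμ : μ ≤ lambdaMin A) {k : ℕ}
    (hr : (cg A b x₀ (k + 1)).r ≠ 0) : cgGamma A b x₀ k < radauGamma A b x₀ μ k := by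
  obtain ⟨hg, q, hq, hqr, hqm⟩ := radauGamma_pos_and_exists hA hμ0 hμ k (r_ne_zero_of_succ hr)
  exact cgGamma_lt_radauGamma_of_exists hA hμ hr hg ⟨q, hq, hqr, hqm _ k.lt_succ_self hr⟩

theorem mul_radauGamma_succ_lt (hA : A.PosDef) (hμ0 : 0 < μ) (hμ : μ ≤ lambdaMin A) {k : ℕ}
    (hr : (cg A b x₀ (k + 1)).r ≠ 0) (h : μ * radauGamma A b x₀ μ k ≤ cgPhi A b x₀ k) :
    μ * radauGamma A b x₀ μ (k + 1) < cgPhi A b x₀ (k + 1) := by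
  have hrk := r_ne_zero_of_succ hr
  have hγ := cgGamma_pos hA hrk
  have hδ := cgDelta_pos hrk hr
  have hφ := cgPhi_pos hA hrk
  have hsub := sub_pos.2 (cgGamma_lt_radauGamma hA hμ0 hμ hr)
  have hlt : μ * (radauGamma A b x₀ μ k - cgGamma A b x₀ k) < cgPhi A b x₀ k := by
    have : 0 < μ * cgGamma A b x₀ k := by positivity
    linarith
  rw [cgPhi_succ hA hrk hr, radauGamma, ← mul_div_assoc,
    div_lt_div_iff₀ (by positivity) (by positivity)]
  have := mul_lt_mul_of_pos_right hlt hδ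
  linarith

theorem mul_radauGamma_zero (hμ : 0 < μ) (hr : b - mulV A x₀ ≠ 0) :
    μ * radauGamma A b x₀ μ 0 = cgPhi A b x₀ 0 := by
  have := norm_ne_zero_iff.2 hr
  rw [radauGamma, mul_one_div_cancel hμ.ne']
  change 1 = ‖b - mulV A x₀‖ ^ 2 / ‖b - mulV A x₀‖ ^ 2
  field_simp

theorem mul_radauGamma_le (hA : A.PosDef) (hμ0 : 0 < μ) (hμ : μ ≤ lambdaMin A) {k : ℕ}
    (hr : (cg A b x₀ k).r ≠ 0) : μ * radauGamma A b x₀ μ k ≤ cgPhi A b x₀ k := by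
  induction k with
  | zero => exact (mul_radauGamma_zero hμ0 hr).le
  | succ k ih => exact (mul_radauGamma_succ_lt hA hμ0 hμ hr (ih (r_ne_zero_of_succ hr))).le

theorem radauGamma_mul_eq (hμ : 0 < μ) (k : ℕ) :
    radauGamma A b x₀ μ k * ‖(cg A b x₀ k).r‖ ^ 2 =
      ‖(cg A b x₀ k).r‖ ^ 2 / μ * (μ * radauGamma A b x₀ μ k) := by
  field_simp

/-! ### Krylov subspaces and the grade -/

theorem mulV_pow_succ (j : ℕ) (v : Vec N) : mulV (A ^ (j + 1)) v = mulV A (mulV (A ^ j) v) := by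
  ext i
  simp [mulV, pow_succ']

theorem krylov_mono (v : Vec N) {j k : ℕ} (h : j ≤ k) : krylov A v j ≤ krylov A v k :=
  Submodule.span_mono (Set.image_mono (Set.Iio_subset_Iio h))

theorem mulV_mem_krylov_succ {v w : Vec N} {k : ℕ} (hw : w ∈ krylov A v k) :
    mulV A w ∈ krylov A v (k + 1) := by
  have h : krylov A v k ≤ (krylov A v (k + 1)).comap (Matrix.toEuclideanLin A) := by
    refine Submodule.span_le.2 ?_
    rintro _ ⟨j, hj, rfl⟩
    refine Submodule.subset_span ⟨j + 1, ?_, mulV_pow_succ j v⟩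
    simpa using hj
  exact h hw

theorem r_mem_krylov_and_p_mem_krylov (k : ℕ) :
    (cg A b x₀ k).r ∈ krylov A (b - mulV A x₀) (k + 1) ∧
      (cg A b x₀ k).p ∈ krylov A (b - mulV A x₀) (k + 1) := by
  induction k with
  | zero =>
    have h : b - mulV A x₀ ∈ krylov A (b - mulV A x₀) (0 + 1) :=
      Submodule.subset_span ⟨0, by simp, by ext i; simp [mulV]⟩
    exact ⟨h, h⟩
  | succ k ih =>
    have hr : (cg A b x₀ (k + 1)).r ∈ krylov A (b - mulV A x₀) (k + 1 + 1) :=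
      sub_mem (krylov_mono _ (Nat.le_succ _) ih.1)
        (Submodule.smul_mem _ _ (mulV_mem_krylov_succ ih.2))
    exact ⟨hr, add_mem hr (Submodule.smul_mem _ _ (krylov_mono _ (Nat.le_succ _) ih.2))⟩

theorem krylov_le_of_invariant {v : Vec N} {S : Submodule ℝ (Vec N)} (hv : v ∈ S)
    (hS : ∀ w ∈ S, mulV A w ∈ S) (m : ℕ) : krylov A v m ≤ S := by
  refine Submodule.span_le.2 ?_
  rintro _ ⟨j, -, rfl⟩
  induction j with
  | zero => simpa [mulV] using hv
  | succ j ih =>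
    change mulV (A ^ (j + 1)) v ∈ S
    rw [mulV_pow_succ]
    exact hS _ ih

/-- At the first zero residual the span of the earlier directions is A-invariant, since A p_j is a
multiple of r_j - r_{j+1}. It therefore contains every Krylov subspace, while lying in the k-th. -/
theorem grade_le_of_r_eq_zero (hA : A.PosDef) {k : ℕ} (hk : (cg A b x₀ k).r = 0) :
    grade A (b - mulV A x₀) ≤ k := by
  classical
  have hex : ∃ k, (cg A b x₀ k).r = 0 := ⟨k, hk⟩
  refine le_trans ?_ (Nat.find_min' hex hk)
  have hk0 := Nat.find_spec hex
  have hmin : ∀ j < Nat.find hex, (cg A b x₀ j).r ≠ 0 := fun j hj => Nat.find_min hex hj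
  generalize Nat.find hex = k at hk0 hmin
  set S : Submodule ℝ (Vec N) :=
    Submodule.span ℝ ((fun j => (cg A b x₀ j).p) '' Set.Iio k) with hS
  have hp : ∀ j < k, (cg A b x₀ j).p ∈ S := fun j hj => Submodule.subset_span ⟨j, hj, rfl⟩
  have hr : ∀ j ≤ k, (cg A b x₀ j).r ∈ S := by
    intro j hj
    rcases hj.lt_or_eq with hj | rfl
    · cases j with
      | zero => exact hp 0 hj
      | succ j =>
        have h := cg_p_succ (A := A) (b := b) (x₀ := x₀) j
        rw [eq_sub_of_add_eq h.symm]
        exact sub_mem (hp _ hj) (Submodule.smul_mem _ _ (hp _ (by omega)))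
    · rw [hk0]; exact zero_mem _
  have hinv : ∀ w ∈ S, mulV A w ∈ S := by
    have h : S ≤ S.comap (Matrix.toEuclideanLin A) := by
      refine Submodule.span_le.2 ?_
      rintro _ ⟨j, hj, rfl⟩
      change mulV A (cg A b x₀ j).p ∈ S
      rw [mulV_p_eq hA (hmin j hj)]
      exact Submodule.smul_mem _ _ (sub_mem (hr j (le_of_lt hj)) (hr (j + 1) hj))
    exact fun w hw => h hw
  have hSK : S ≤ krylov A (b - mulV A x₀) k := by
    refine Submodule.span_le.2 ?_
    rintro _ ⟨j, hj, rfl⟩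
    exact krylov_mono _ hj (r_mem_krylov_and_p_mem_krylov j).2
  exact Nat.sInf_le fun m => Submodule.finrank_mono
    ((krylov_le_of_invariant (hr 0 (Nat.zero_le _)) hinv m).trans hSK)

end CGBound

/-! ### Assembly -/

theorem mainTheorem1 {N : ℕ} (A : Matrix (Fin N) (Fin N) ℝ) (hA : A.PosDef)
    (b x₀ x : CGBound.Vec N) (hx : CGBound.mulV A x = b)
    (μ : ℝ) (hμ_pos : 0 < μ) (hμ_le : μ ≤ CGBound.lambdaMin A)
    (r₀ : CGBound.Vec N) (hr₀ : r₀ = b - CGBound.mulV A x₀)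
    (n : ℕ) (hn : n = CGBound.grade A r₀) :
    (CGBound.mulV A r₀ ≠ μ • r₀ → ∀ k < n,
      CGBound.aNorm A (x - (CGBound.cg A b x₀ k).x) ^ 2 < CGBound.newBound A b x₀ μ k) ∧
    (CGBound.mulV A r₀ = μ • r₀ → ∀ k < n,
      CGBound.aNorm A (x - (CGBound.cg A b x₀ k).x) ^ 2 = CGBound.newBound A b x₀ μ k) ∧
    StrictAntiOn (CGBound.newBound A b x₀ μ) (Set.Iio n) ∧
    (∀ k < n,
      μ * CGBound.radauGamma A b x₀ μ k ≤ CGBound.cgPhi A b x₀ k ∧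
      CGBound.radauGamma A b x₀ μ k * ‖(CGBound.cg A b x₀ k).r‖ ^ 2 ≤
        CGBound.newBound A b x₀ μ k) ∧
    (∀ k < n, 1 ≤ k →
      CGBound.radauGamma A b x₀ μ k * ‖(CGBound.cg A b x₀ k).r‖ ^ 2 <
        CGBound.newBound A b x₀ μ k) ∧
    (∀ k d : ℕ, 0 < d → k + d < n →
      CGBound.aNorm A (x - (CGBound.cg A b x₀ k).x) ^ 2 <
        ∑ j ∈ Finset.Ico k (k + d),
            CGBound.cgGamma A b x₀ j * ‖(CGBound.cg A b x₀ j).r‖ ^ 2 +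
          CGBound.newBound A b x₀ μ (k + d)) := by
  subst hr₀ hn
  have hr : ∀ k < CGBound.grade A (b - CGBound.mulV A x₀), (CGBound.cg A b x₀ k).r ≠ 0 :=
    fun k hk h => absurd (CGBound.grade_le_of_r_eq_zero hA h) (not_le.2 hk)
  have hφ : ∀ k, CGBound.newBound A b x₀ μ k =
      ‖(CGBound.cg A b x₀ k).r‖ ^ 2 / μ * CGBound.cgPhi A b x₀ k := CGBound.newBound_eq
  refine ⟨fun h k hk => ?_, fun h k hk => ?_, ?_, fun k hk => ?_, fun k hk hk1 => ?_,
    fun k d hd hkd => ?_⟩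
  · cases k with
    | zero => exact CGBound.energy_zero_lt_newBound hA hx hμ_pos hμ_le (hr 0 hk) h
    | succ k => exact CGBound.energy_succ_lt_newBound hA hx hμ_pos hμ_le (hr _ hk)
  · cases k with
    | zero => exact CGBound.energy_zero_eq_newBound hA hx hμ_pos h
    | succ k =>
      exact absurd (CGBound.r_one_eq_zero hμ_pos h) (CGBound.r_ne_zero_of_le (by omega) (hr _ hk))
  · intro j _ m hm hjm
    have hm' : m < CGBound.grade A (b - CGBound.mulV A x₀) := hm
    clear hm
    induction m, Nat.succ_le_of_lt hjm using Nat.le_induction with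
    | base => exact CGBound.newBound_succ_lt hA hμ_pos (hr j (by omega)) (hr _ hm')
    | succ m hjm ih =>
      exact (CGBound.newBound_succ_lt hA hμ_pos (hr m (by omega)) (hr _ hm')).trans
        (ih (by omega) (by omega))
  · have h := CGBound.mul_radauGamma_le hA hμ_pos hμ_le (hr k hk)
    refine ⟨h, ?_⟩
    rw [CGBound.radauGamma_mul_eq hμ_pos, hφ]
    gcongr
  · obtain ⟨k, rfl⟩ := Nat.exists_eq_add_of_le' hk1
    have h := CGBound.mul_radauGamma_succ_lt hA hμ_pos hμ_le (hr _ hk)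
      (CGBound.mul_radauGamma_le hA hμ_pos hμ_le (hr k (by omega)))
    have hn := norm_pos_iff.2 (hr _ hk)
    rw [CGBound.radauGamma_mul_eq hμ_pos, hφ]
    gcongr
  -- As d > 0, the last index is a successor, where the bound is strict even if r_0 is an
  -- eigenvector.
  · obtain ⟨d, rfl⟩ := Nat.exists_eq_add_of_le' (Nat.succ_le_of_lt hd)
    rw [CGBound.energy_eq_sum hA hx k (d + 1)]
    gcongr
    exact CGBound.energy_succ_lt_newBound hA hx hμ_pos hμ_le (hr _ hkd)
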